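/- Let $K$ be a number field of degree $n=[K:\mathbb{Q}]$, let $K'\subseteq K$ be a subfield, let $q$ be a prime number and let $l\geq 1$ be an integer such that $q^l\,\|\,[K:K']$, i.e. $q^l\mid[K:K']$ and $q^{l+1}\nmid[K:K']$. For a prime number $p$ with $p\mathcal{O}_K=\mathfrak{p}_1^{e_1}\cdots\mathfrak{p}_m^{e_m}$ ($\mathfrak{p}_i$ distinct prime ideals, $e_i\geq 1$) put $e_K(p):=\gcd(e_1,\dots,e_m)$, and call $p$ a ramified prime of type $q^l$ if $q^l\mid e_K(p)$. Let $\operatorname{Cl}(K/K')$ be the relative class group, i.e. the kernel of the homomorphism $\operatorname{Nm}_{K/K'}:\operatorname{Cl}_K\to\operatorname{Cl}_{K'}$ induced by the relative norm of ideals, and for a finite abelian group $A$ let $\operatorname{rk}_q A:=\dim_{\mathbb{F}_q}A/qA$ be its $q$-rank. Then there are only finitely many ramified primes of type $q^l$, and \[\operatorname{rk}_q\bigl(q^{l-1}\operatorname{Cl}(K/K')\bigr)\ \geq\ \#\{p\ :\ p\text{ is a ramified prime of type }q^l\}-2(n-1).\] -/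

import Mathlib

open scoped NumberField nonZeroDivisors

noncomputable section

/-- The `q`-rank of a commutative group `G` (written multiplicatively), `q` prime: the dimension of
`G / G ^ q` as a vector space over the field with `q` elements. -/
def groupRank (q : ℕ) (G : Type*) [CommGroup G] : ℕ :=
  Module.finrank (ZMod q) (ModN (Additive G) q)

section ClassGroupNorm

/-- The relative norm on nonzero ideals of an extension `S / R` of Dedekind domains. -/
def relNormNonzero (R S : Type*) [CommRing R] [IsDedekindDomain R] [CommRing S]
    [IsDedekindDomain S] [Algebra R S] [Module.Finite R S] [Module.IsTorsionFree R S] :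
    (Ideal S)⁰ →* (Ideal R)⁰ where
  toFun I := ⟨Ideal.relNorm R (I : Ideal S), mem_nonZeroDivisors_iff_ne_zero.mpr fun h =>
    mem_nonZeroDivisors_iff_ne_zero.mp I.2 (Ideal.relNorm_eq_bot_iff.mp h)⟩
  map_one' := by ext1; simp
  map_mul' I J := by ext1; simp

theorem mk0_relNormNonzero_congr (R S : Type*) [CommRing R] [IsDedekindDomain R] [CommRing S]
    [IsDedekindDomain S] [Algebra R S] [Module.Finite R S] [Module.IsTorsionFree R S]
    {I J : (Ideal S)⁰} (h : ClassGroup.mk0 I = ClassGroup.mk0 J) :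
    ClassGroup.mk0 (relNormNonzero R S I) = ClassGroup.mk0 (relNormNonzero R S J) := by
  obtain ⟨x, y, hx, hy, hxy⟩ := ClassGroup.mk0_eq_mk0_iff.mp h
  refine ClassGroup.mk0_eq_mk0_iff.mpr
    ⟨Algebra.intNorm R S x, Algebra.intNorm R S y, ?_, ?_, ?_⟩
  · exact Algebra.intNorm_ne_zero.mpr hx
  · exact Algebra.intNorm_ne_zero.mpr hy
  · simpa [relNormNonzero] using congrArg (Ideal.relNorm R) hxy

/-- The norm homomorphism on class groups, induced by the relative norm of ideals: the class of a
nonzero ideal `I` is sent to the class of the relative norm of `I`. -/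
def classGroupNorm (R S : Type*) [CommRing R] [IsDedekindDomain R] [CommRing S]
    [IsDedekindDomain S] [Algebra R S] [Module.Finite R S] [Module.IsTorsionFree R S] :
    ClassGroup S →* ClassGroup R :=
  MonoidHom.mk'
    (fun c => ClassGroup.mk0
      (relNormNonzero R S (Function.surjInv ClassGroup.mk0_surjective c)))
    fun a b => by
      rw [← map_mul, ← map_mul]
      refine mk0_relNormNonzero_congr R S ?_
      rw [map_mul]
      simp only [Function.surjInv_eq]

/-- The defining property of the norm on class groups. -/
theorem classGroupNorm_mk0 (R S : Type*) [CommRing R] [IsDedekindDomain R] [CommRing S]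
    [IsDedekindDomain S] [Algebra R S] [Module.Finite R S] [Module.IsTorsionFree R S]
    (I : (Ideal S)⁰) :
    classGroupNorm R S (ClassGroup.mk0 I) = ClassGroup.mk0 (relNormNonzero R S I) :=
  mk0_relNormNonzero_congr R S (Function.surjInv_eq ClassGroup.mk0_surjective _)

end ClassGroupNorm

/-- The relative class group `Cl(K / K')`: the kernel of the norm map `Cl_K → Cl_{K'}`. -/
def relativeClassGroup (K' K : Type*) [Field K'] [NumberField K'] [Field K] [NumberField K]
    [Algebra K' K] : Subgroup (ClassGroup (𝓞 K)) :=
  (classGroupNorm (𝓞 K') (𝓞 K)).ker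

/-- `e_K(p)`: the greatest common divisor of the ramification indices `e₁, …, eₘ` in the
factorization `p 𝓞_K = 𝔭₁ ^ e₁ ⋯ 𝔭ₘ ^ eₘ` of a rational prime `p`. -/
def ramificationGcd (K : Type*) [Field K] [NumberField K] (p : ℕ) : ℕ :=
  (IsDedekindDomain.primesOverFinset (Ideal.span {(p : ℤ)}) (𝓞 K)).gcd
    fun P => P.ramificationIdx ℤ

/-- A rational prime `p` is a ramified prime of type `m` in `K` if `m ∣ e_K(p)`; here `m > 1` is a
power `q ^ l`, `l ≥ 1`, of a prime number `q`. -/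
def IsRamifiedPrimeOfType (K : Type*) [Field K] [NumberField K] (m p : ℕ) : Prop :=
  p.Prime ∧ m ∣ ramificationGcd K p

end

/-! Let `T` be a finite set of ramified primes of type `q ^ l`. For `p` in `T` there is an ideal
`I_p` with `I_p ^ (q ^ l) = (p)`, and its class lies in the relative class group. The classes of
`I_p ^ (q ^ (l - 1))` are killed by `q`, so they define a map from `ℤ^T` to the `q`-torsion of `q ^
(l - 1) Cl(K/K')`, a group of order `q ^ rk`. A vector `c` in its kernel makes `∏ p ^ c p` a unit
times a `q`-th power of `K`.

It remains to compare indices in the chain `q ℤ^T ≤ powExponents ≤ unitPowExponents ≤ ℤ^T`, of total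
index `q ^ #T`. The top step is at most `q ^ rk`. The middle step measures units modulo `q`-th
powers, and Dirichlet's theorem bounds it by `q ^ (n - 1)`. The bottom step is at most `n ≤ q ^ (n -
1)`, since `q`-th roots of rationals that differ modulo rational `q`-th powers are linearly
independent over `ℚ`. The bound is uniform in `T`, so it also yields finiteness. -/

noncomputable section

/-! ### Traces of radicals, and counting tools -/

/-- A family of nonzero elements whose pairwise quotients have trace zero is linearly independent. -/
theorem linearIndependent_of_trace_div_eq_zero {F K ι : Type*} [Field F] [CharZero F] [Field K]
    [Algebra F K] [FiniteDimensional F K] (v : ι → K) (hv : ∀ i, v i ≠ 0)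
    (h : ∀ i j, i ≠ j → Algebra.trace F K (v i / v j) = 0) : LinearIndependent F v := by
  rw [linearIndependent_iff']
  intro s g hg j hj
  have h1 : ∑ i ∈ s, g i • (v i / v j) = 0 := by
    have := congrArg (· / v j) hg
    simpa [Finset.sum_div, smul_div_assoc] using this
  have h2 := congrArg (Algebra.trace F K) h1
  rw [map_sum, Finset.sum_eq_single_of_mem j hj, map_smul, div_self (hv j), map_zero,
    ← map_one (algebraMap F K), Algebra.trace_algebraMap] at h2
  · have : (Module.finrank F K : F) ≠ 0 := Nat.cast_ne_zero.mpr Module.finrank_pos.ne'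
    simpa [this] using h2
  · intro i _ hij
    rw [map_smul, h i j hij, smul_zero]

/-- The minimal polynomial is `X ^ q - a`, which has no term of degree `q - 1` because `q ≥ 2`. -/
theorem trace_eq_zero_of_pow_eq_algebraMap {F K : Type*} [Field F] [Field K] [Algebra F K]
    [FiniteDimensional F K] {q : ℕ} (hq : q.Prime) {a : F} (ha : ∀ b : F, b ^ q ≠ a) {x : K}
    (hx : x ^ q = algebraMap F K a) : Algebra.trace F K x = 0 := by
  have hirr := X_pow_sub_C_irreducible_of_prime hq ha
  have hmin : minpoly F x = Polynomial.X ^ q - Polynomial.C a :=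
    (minpoly.eq_of_irreducible_of_monic hirr (by simp [hx])
      (Polynomial.monic_X_pow_sub_C a hq.ne_zero)).symm
  rw [trace_eq_finrank_mul_minpoly_nextCoeff, hmin]
  have hdeg : (Polynomial.X ^ q - Polynomial.C a).natDegree = q := Polynomial.natDegree_X_pow_sub_C
  have h2 := hq.two_le
  rw [Polynomial.nextCoeff_of_natDegree_pos (by omega), hdeg, Polynomial.coeff_sub,
    Polynomial.coeff_X_pow, Polynomial.coeff_C, if_neg (by omega), if_neg (by omega)]
  simp

/-- Labels in `C` need not be unique: any choice of labels for coset representatives is injective on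
cosets. -/
theorem AddSubgroup.relIndex_le_natCard_of_rel {G C : Type*} [AddGroup G] [Finite C]
    (H N : AddSubgroup G) (R : G → C → Prop) (h₁ : ∀ b ∈ N, ∃ c, R b c)
    (h₂ : ∀ b b' c, R b c → R b' c → -b + b' ∈ H) : H.relIndex N ≤ Nat.card C := by
  choose f hf using h₁
  rw [AddSubgroup.relIndex, AddSubgroup.index]
  refine Nat.card_le_card_of_injective
    (fun x : N ⧸ H.addSubgroupOf N => f x.out.1 x.out.2) fun x y hxy => ?_
  have hx := hf x.out.1 x.out.2
  have hy := hf y.out.1 y.out.2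
  simp only at hxy
  rw [← hxy] at hy
  rw [← QuotientAddGroup.out_eq' x, ← QuotientAddGroup.out_eq' y, QuotientAddGroup.eq]
  exact h₂ _ _ _ hx hy

/-- In a finite commutative group, the elements killed by a prime `q` number `q ^ rank`. -/
theorem natCard_ker_powMonoidHom {q : ℕ} (hq : q.Prime) (G : Type*) [CommGroup G] [Finite G] :
    Nat.card (powMonoidHom q : G →* G).ker = q ^ groupRank q G := by
  have : Fact q.Prime := ⟨hq⟩
  have hfin : Finite (ModN (Additive G) q) :=
    Finite.of_surjective _ (Submodule.mkQ_surjective _)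
  have h1 : Nat.card (ModN (Additive G) q) = q ^ groupRank q G := by
    rw [Module.natCard_eq_pow_finrank (K := ZMod q), Nat.card_zmod, groupRank]
  have h2 : Nat.card (ModN (Additive G) q) = (powMonoidHom q : G →* G).range.index := by
    rw [Subgroup.index]
    refine Nat.card_congr (Quotient.congr Additive.toMul fun a b => ?_)
    change QuotientAddGroup.leftRel _ a b ↔ QuotientGroup.leftRel _ _ _
    rw [QuotientAddGroup.leftRel_apply, QuotientGroup.leftRel_apply, Submodule.mem_toAddSubgroup]
    constructor
    · rintro ⟨x, hx⟩
      exact ⟨x.toMul, by simpa using congrArg Additive.toMul hx⟩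
    · rintro ⟨x, hx⟩
      exact ⟨Additive.ofMul x, by simpa using congrArg Additive.ofMul hx⟩
  rw [← h1, h2]
  have h3 := (powMonoidHom q : G →* G).range.card_mul_index
  have h4 := (powMonoidHom q : G →* G).ker.card_mul_index
  rw [Subgroup.index_ker, ← h3, mul_comm] at h4
  exact Nat.eq_of_mul_eq_mul_left Nat.card_pos h4

/-! ### Products of primes that are `q`-th powers in `K` -/

/-- The element `∏ p ^ c p` of `Kˣ`, the product being over a finite set of natural numbers. -/
def primeProd (K : Type*) [Field K] [CharZero K] (T : Finset ℕ) (hT : ∀ p ∈ T, p.Prime)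
    (c : T → ℤ) : Kˣ :=
  ∏ p : T, Units.mk0 ((p : ℕ) : K) (Nat.cast_ne_zero.mpr (hT p p.2).ne_zero) ^ c p

section PrimeProd

variable (K : Type*) [Field K] [CharZero K] {T : Finset ℕ} (hT : ∀ p ∈ T, p.Prime)

theorem primeProd_zero : primeProd K T hT 0 = 1 := by simp [primeProd]

theorem primeProd_add (c d : T → ℤ) :
    primeProd K T hT (c + d) = primeProd K T hT c * primeProd K T hT d := by
  simp [primeProd, zpow_add, Finset.prod_mul_distrib]

theorem primeProd_neg (c : T → ℤ) : primeProd K T hT (-c) = (primeProd K T hT c)⁻¹ := by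
  simp [primeProd]

theorem val_primeProd (c : T → ℤ) :
    (primeProd K T hT c : K) = algebraMap ℚ K (∏ p : T, ((p : ℕ) : ℚ) ^ c p) := by
  simp [primeProd, Units.coe_prod]

/-- The exponent vectors `c` for which `∏ p ^ c p` is a `q`-th power in `K`. -/
def powExponents (q : ℕ) : AddSubgroup (T → ℤ) where
  carrier := {c | ∃ x : Kˣ, x ^ q = primeProd K T hT c}
  zero_mem' := ⟨1, by rw [one_pow, primeProd_zero]⟩
  add_mem' := by
    rintro c d ⟨x, hx⟩ ⟨y, hy⟩
    exact ⟨x * y, by rw [mul_pow, hx, hy, primeProd_add]⟩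
  neg_mem' := by
    rintro c ⟨x, hx⟩
    exact ⟨x⁻¹, by rw [inv_pow, hx, primeProd_neg]⟩

end PrimeProd

/-- The exponent vectors divisible by `q`. -/
def mulExponents (q : ℕ) (ι : Type*) : AddSubgroup (ι → ℤ) :=
  ((Int.castAddHom (ZMod q)).compLeft ι).ker

theorem mem_mulExponents {q : ℕ} {ι : Type*} {c : ι → ℤ} :
    c ∈ mulExponents q ι ↔ ∀ i, (q : ℤ) ∣ c i := by
  simp [mulExponents, AddMonoidHom.mem_ker, funext_iff, ZMod.intCast_zmod_eq_zero_iff_dvd]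

theorem index_mulExponents (q : ℕ) (ι : Type*) [Fintype ι] :
    (mulExponents q ι).index = q ^ Fintype.card ι := by
  have hsurj : Function.Surjective ((Int.castAddHom (ZMod q)).compLeft ι) := fun f =>
    ⟨fun i => (f i).cast, funext fun i => ZMod.intCast_zmod_cast (f i)⟩
  rw [mulExponents, AddSubgroup.index_ker, AddMonoidHom.range_eq_top.mpr hsurj,
    AddSubgroup.card_top, Nat.card_fun, Nat.card_zmod, Nat.card_eq_fintype_card]

theorem padicValRat_prod_zpow {T : Finset ℕ} (hT : ∀ p ∈ T, p.Prime) (c : T → ℤ) (p : T) :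
    padicValRat p (∏ s : T, ((s : ℕ) : ℚ) ^ c s) = c p := by
  classical
  have hp : Fact (p : ℕ).Prime := ⟨hT p p.2⟩
  have key : ∀ S : Finset T,
      padicValRat p (∏ s ∈ S, ((s : ℕ) : ℚ) ^ c s) = ∑ s ∈ S, if s = p then c s else 0 := by
    intro S
    induction S using Finset.induction_on with
    | empty => simp
    | insert s S hs ih =>
      have h0 : ∀ s : T, ((s : ℕ) : ℚ) ^ c s ≠ 0 := fun s =>
        zpow_ne_zero _ (Nat.cast_ne_zero.mpr (hT s s.2).ne_zero)
      rw [Finset.prod_insert hs, Finset.sum_insert hs, padicValRat.mul (h0 s)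
        (Finset.prod_ne_zero_iff.mpr fun s _ => h0 s), ih, padicValRat.zpow]
      congr 1
      split_ifs with h
      · subst h
        simp [padicValRat.self hp.out.one_lt]
      · have : padicValNat p s = 0 := by
          have hs' : Fact (s : ℕ).Prime := ⟨hT s s.2⟩
          exact padicValNat_primes fun h' => h (Subtype.ext h'.symm)
        simp [padicValRat.of_nat, this]
  rw [key, Finset.sum_ite_eq' Finset.univ p]
  simp

theorem mem_mulExponents_of_pow_eq {q : ℕ} {T : Finset ℕ} (hT : ∀ p ∈ T, p.Prime) {c : T → ℤ}
    {r : ℚ} (h : r ^ q = ∏ p : T, ((p : ℕ) : ℚ) ^ c p) : c ∈ mulExponents q T := by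
  rw [mem_mulExponents]
  intro p
  have hp : Fact (p : ℕ).Prime := ⟨hT p p.2⟩
  rw [← padicValRat_prod_zpow hT c p, ← h, padicValRat.pow]
  exact dvd_mul_right _ _

/-- Choose a `q`-th root for each coset. The quotient of two of them has a rational `q`-th power
which, by `p`-adic valuations, is not a `q`-th power in `ℚ`; its trace is therefore zero and the
roots are independent. -/
theorem relIndex_mulExponents_powExponents_le (K : Type*) [Field K] [NumberField K] {q : ℕ}
    (hq : q.Prime) {T : Finset ℕ} (hT : ∀ p ∈ T, p.Prime) :
    (mulExponents q T).relIndex (powExponents K hT q) ≤ Module.finrank ℚ K := by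
  set H := (mulExponents q T).addSubgroupOf (powExponents K hT q)
  choose β hβ using fun c : powExponents K hT q => c.2
  have hli : LinearIndependent ℚ fun x : powExponents K hT q ⧸ H => (β x.out : K) := by
    refine linearIndependent_of_trace_div_eq_zero _ (fun x => (β x.out).ne_zero) fun x y hxy => ?_
    refine trace_eq_zero_of_pow_eq_algebraMap hq
      (a := ∏ p : T, ((p : ℕ) : ℚ) ^ (x.out.1 + -y.out.1) p) (fun r hr => ?_) ?_
    · apply hxy.symm
      rw [← QuotientAddGroup.out_eq' x, ← QuotientAddGroup.out_eq' y, QuotientAddGroup.eq,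
        AddSubgroup.mem_addSubgroupOf]
      have := mem_mulExponents_of_pow_eq hT hr
      rwa [add_comm] at this
    · rw [← val_primeProd K hT, primeProd_add, primeProd_neg, ← hβ, ← hβ]
      simp [div_eq_mul_inv, mul_pow]
  have hfin : Finite (powExponents K hT q ⧸ H) := hli.finite
  have := Fintype.ofFinite (powExponents K hT q ⧸ H)
  rw [AddSubgroup.relIndex, AddSubgroup.index, Nat.card_eq_fintype_card]
  exact hli.fintype_card_le_finrank

/-! ### The contribution of the units -/

open NumberField NumberField.Units

/-- The exponent vectors `c` for which `∏ p ^ c p` is the product of a `q`-th power in `K` and a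
unit of `𝓞 K`. -/
def unitPowExponents (K : Type*) [Field K] [NumberField K] {T : Finset ℕ}
    (hT : ∀ p ∈ T, p.Prime) (q : ℕ) : AddSubgroup (T → ℤ) where
  carrier := {c | ∃ (x : Kˣ) (u : (𝓞 K)ˣ),
    x ^ q = Units.map (algebraMap (𝓞 K) K) u * primeProd K T hT c}
  zero_mem' := ⟨1, 1, by simp [primeProd_zero]⟩
  add_mem' := by
    rintro c d ⟨x, u, hx⟩ ⟨y, v, hy⟩
    exact ⟨x * y, u * v, by rw [mul_pow, hx, hy, primeProd_add, map_mul, mul_mul_mul_comm]⟩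
  neg_mem' := by
    rintro c ⟨x, u, hx⟩
    exact ⟨x⁻¹, u⁻¹, by rw [inv_pow, hx, primeProd_neg, mul_inv, map_inv]⟩

/-- Products of powers of the same elements, with exponents congruent modulo `q`, differ by a
`q`-th power. -/
theorem exists_prod_zpow_eq_of_intCast_eq {q : ℕ} {G ι : Type*} [CommGroup G] [Fintype ι]
    (ε : ι → G) {e f : ι → ℤ} (h : ∀ i, (e i : ZMod q) = f i) :
    ∃ w : G, ∏ i, ε i ^ f i = (∏ i, ε i ^ e i) * w ^ q := by
  choose m hm using fun i => (ZMod.intCast_eq_intCast_iff_dvd_sub _ _ _).mp (h i)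
  refine ⟨∏ i, ε i ^ m i, ?_⟩
  rw [← Finset.prod_pow, ← Finset.prod_mul_distrib]
  refine Finset.prod_congr rfl fun i _ => ?_
  rw [← zpow_natCast, ← zpow_mul, ← zpow_add, mul_comm (m i), ← hm]
  congr 1
  ring

section UnitPowExponents

variable {K : Type*} [Field K] [NumberField K]

/-- Fundamental units with exponents congruent modulo `q` cancel up to a `q`-th power, so only a
root of unity is left. -/
theorem exists_pow_eq_torsion_mul {q : ℕ} {T : Finset ℕ} (hT : ∀ p ∈ T, p.Prime)
    {e e' : Fin (rank K) → ℤ} (he : ∀ i, (e i : ZMod q) = e' i) {x x' : Kˣ} {ζ ζ' : (𝓞 K)ˣ}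
    {c c' : T → ℤ}
    (h : x ^ q = Units.map (algebraMap (𝓞 K) K) (ζ * ∏ i, fundSystem K i ^ e i) *
      primeProd K T hT c)
    (h' : x' ^ q = Units.map (algebraMap (𝓞 K) K) (ζ' * ∏ i, fundSystem K i ^ e' i) *
      primeProd K T hT c') :
    ∃ y : Kˣ, y ^ q = Units.map (algebraMap (𝓞 K) K) (ζ⁻¹ * ζ') *
      primeProd K T hT (-c + c') := by
  obtain ⟨w, hw⟩ := exists_prod_zpow_eq_of_intCast_eq (fundSystem K) he
  refine ⟨x⁻¹ * x' * (Units.map (algebraMap (𝓞 K) K) w)⁻¹, ?_⟩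
  rw [mul_pow, mul_pow, inv_pow, inv_pow, h, h', hw, primeProd_add, primeProd_neg]
  simp only [map_mul, map_inv, map_pow]
  generalize Units.map (algebraMap (𝓞 K) K : 𝓞 K →* K) (∏ i, fundSystem K i ^ e i) = E
  rw [mul_inv, mul_inv, mul_inv_eq_iff_eq_mul]
  simp only [mul_comm, mul_left_comm, mul_assoc]
  rw [mul_left_comm _ E⁻¹, mul_inv_cancel_left]

/-- The extra factor `q` comes from the torsion units, which are cyclic. -/
theorem relIndex_powExponents_unitPowExponents_le_rank_add_one {q : ℕ} (hq : q.Prime)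
    {T : Finset ℕ} (hT : ∀ p ∈ T, p.Prime) :
    (powExponents K hT q).relIndex (unitPowExponents K hT q) ≤ q ^ (rank K + 1) := by
  have : NeZero q := ⟨hq.ne_zero⟩
  obtain ⟨g, hg⟩ := IsCyclic.exists_generator (α := torsion K)
  have hcard : Nat.card ((Fin (rank K) → ZMod q) × ZMod q) = q ^ (rank K + 1) := by
    rw [Nat.card_prod, Nat.card_fun, Nat.card_zmod, Nat.card_eq_fintype_card, Fintype.card_fin,
      pow_succ]
  rw [← hcard]
  refine AddSubgroup.relIndex_le_natCard_of_rel _ _ (fun c t => ∃ (x : Kˣ) (k : ℤ)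
    (e : Fin (rank K) → ℤ), (fun i => (e i : ZMod q)) = t.1 ∧ (k : ZMod q) = t.2 ∧
    x ^ q = Units.map (algebraMap (𝓞 K) K)
      (((g ^ k : torsion K) : (𝓞 K)ˣ) * ∏ i, fundSystem K i ^ e i) * primeProd K T hT c) ?_ ?_
  · rintro c ⟨x, u, hx⟩
    obtain ⟨⟨ζ, e⟩, hu, -⟩ := exist_unique_eq_mul_prod K u
    obtain ⟨k, rfl⟩ := hg ζ
    exact ⟨(fun i => (e i : ZMod q), k), x, k, e, rfl, rfl, by rw [hx, hu]⟩
  · rintro c c' t ⟨x, k, e, he, hk, hx⟩ ⟨x', k', e', he', hk', hx'⟩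
    obtain ⟨y, hy⟩ := exists_pow_eq_torsion_mul hT (fun i => congrFun (he.trans he'.symm) i) hx hx'
    obtain ⟨m, hm⟩ := (ZMod.intCast_eq_intCast_iff_dvd_sub _ _ _).mp (hk.trans hk'.symm)
    refine ⟨y * (Units.map (algebraMap (𝓞 K) K) ((g : (𝓞 K)ˣ) ^ m))⁻¹, ?_⟩
    have : ((g ^ k : torsion K) : (𝓞 K)ˣ)⁻¹ * ((g ^ k' : torsion K) : (𝓞 K)ˣ)
        = ((g : (𝓞 K)ˣ) ^ m) ^ q := by
      rw [Subgroup.coe_zpow, Subgroup.coe_zpow, ← zpow_neg, ← zpow_add, ← zpow_natCast, ← zpow_mul,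
        mul_comm m, ← hm, neg_add_eq_sub]
    rw [mul_pow, hy, this, map_pow, inv_pow, mul_right_comm, mul_inv_cancel, one_mul]

/-- A real embedding forces the torsion to be `±1`, and the sign costs nothing: it is a `q`-th power
for odd `q`, and positivity of `∏ p ^ c p` excludes it for `q = 2`. -/
theorem relIndex_powExponents_unitPowExponents_le_of_real {q : ℕ} (hq : q.Prime)
    {T : Finset ℕ} (hT : ∀ p ∈ T, p.Prime) (φ : K →+* ℝ) :
    (powExponents K hT q).relIndex (unitPowExponents K hT q) ≤ q ^ rank K := by
  have : NeZero q := ⟨hq.ne_zero⟩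
  have hcard : Nat.card (Fin (rank K) → ZMod q) = q ^ rank K := by
    rw [Nat.card_fun, Nat.card_zmod, Nat.card_eq_fintype_card, Fintype.card_fin]
  rw [← hcard]
  refine AddSubgroup.relIndex_le_natCard_of_rel _ _ (fun c t => ∃ (x : Kˣ) (ζ : torsion K)
    (e : Fin (rank K) → ℤ), (fun i => (e i : ZMod q)) = t ∧
    x ^ q = Units.map (algebraMap (𝓞 K) K)
      ((ζ : (𝓞 K)ˣ) * ∏ i, fundSystem K i ^ e i) * primeProd K T hT c) ?_ ?_
  · rintro c ⟨x, u, hx⟩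
    obtain ⟨⟨ζ, e⟩, hu, -⟩ := exist_unique_eq_mul_prod K u
    exact ⟨fun i => (e i : ZMod q), x, ζ, e, rfl, by rw [hx, hu]⟩
  · rintro c c' t ⟨x, ζ, e, he, hx⟩ ⟨x', ζ', e', he', hx'⟩
    obtain ⟨y, hy⟩ := exists_pow_eq_torsion_mul hT (fun i => congrFun (he.trans he'.symm) i) hx hx'
    set ξ : torsion K := ζ⁻¹ * ζ' with hξ
    set z : Kˣ := Units.map (algebraMap (𝓞 K) K) (ξ : (𝓞 K)ˣ) with hz
    have hy' : y ^ q = z * primeProd K T hT (-c + c') := hy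
    have hpos : 0 < φ (primeProd K T hT (-c + c') : K) := by
      rw [val_primeProd, ← RingHom.comp_apply, eq_ratCast]
      have : 0 < ∏ p : T, ((p : ℕ) : ℚ) ^ (-c + c') p :=
        Finset.prod_pos fun p _ => zpow_pos (Nat.cast_pos.mpr (hT p p.2).pos) _
      exact_mod_cast this
    have hz1 : z = 1 ∨ z = -1 := by
      obtain ⟨n, hn, hξn⟩ := isOfFinOrder_iff_pow_eq_one.mp (isOfFinOrder_of_finite ξ)
      have h1 : φ (z : K) ^ n = 1 := by
        rw [← map_pow, ← Units.val_pow_eq_pow_val, hz, ← map_pow, ← Subgroup.coe_pow, hξn]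
        simp
      rcases eq_or_eq_neg_of_abs_eq ((pow_eq_one_iff_of_nonneg (abs_nonneg _) hn.ne').mp
        (by rw [← abs_pow, h1, abs_one]) : |φ (z : K)| = 1) with h | h
      · left
        exact Units.ext (φ.injective (by simpa using h))
      · right
        exact Units.ext (φ.injective (by simpa using h))
    rcases hz1 with h | h
    · exact ⟨y, by rw [hy', h, one_mul]⟩
    · rcases hq.eq_two_or_odd' with rfl | hodd
      · exfalso
        have h2 : φ (y : K) ^ 2 = -φ (primeProd K T hT (-c + c') : K) := by
          rw [← map_pow, ← Units.val_pow_eq_pow_val, hy', h]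
          simp
        nlinarith [sq_nonneg (φ (y : K))]
      · exact ⟨-y, by rw [hodd.neg_pow, hy', h]; simp⟩

theorem relIndex_powExponents_unitPowExponents_le {q : ℕ} (hq : q.Prime)
    {T : Finset ℕ} (hT : ∀ p ∈ T, p.Prime) (hn : 2 ≤ Module.finrank ℚ K) :
    (powExponents K hT q).relIndex (unitPowExponents K hT q) ≤
      q ^ (Module.finrank ℚ K - 1) := by
  classical
  have h1 := InfinitePlace.card_add_two_mul_card_eq_rank K
  have h2 := InfinitePlace.card_eq_nrRealPlaces_add_nrComplexPlaces K
  have h3 : rank K = Fintype.card (InfinitePlace K) - 1 := rfl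
  -- Without real places, `rank + 1 = n / 2 ≤ n - 1`; otherwise `rank = r₁ + r₂ - 1 ≤ n - 1`.
  by_cases hr : InfinitePlace.nrRealPlaces K = 0
  · exact (relIndex_powExponents_unitPowExponents_le_rank_add_one hq hT).trans
      (Nat.pow_le_pow_right hq.pos (by omega))
  · obtain ⟨w, hw⟩ := Fintype.card_pos_iff.mp (Nat.pos_of_ne_zero hr)
    exact (relIndex_powExponents_unitPowExponents_le_of_real hq hT
      (InfinitePlace.embedding_of_isReal hw)).trans (Nat.pow_le_pow_right hq.pos (by omega))

end UnitPowExponents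

/-! ### Ideals whose powers are `(p)`, and their classes -/

theorem exists_pow_eq_span_of_isRamifiedPrimeOfType {K : Type*} [Field K] [NumberField K]
    {m p : ℕ} (h : IsRamifiedPrimeOfType K m p) :
    ∃ I : (Ideal (𝓞 K))⁰, (I : Ideal (𝓞 K)) ^ m =
      (Ideal.span {(p : ℤ)}).map (algebraMap ℤ (𝓞 K)) := by
  obtain ⟨hp, hm⟩ := h
  have hpZ : Prime (p : ℤ) := Nat.prime_iff_prime_int.mp hp
  have hbot : Ideal.span {(p : ℤ)} ≠ ⊥ := by simpa using hp.ne_zero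
  have hmax : (Ideal.span {(p : ℤ)}).IsMaximal :=
    PrincipalIdealRing.isMaximal_of_irreducible hpZ.irreducible
  have hI : (∏ P ∈ IsDedekindDomain.primesOverFinset (Ideal.span {(p : ℤ)}) (𝓞 K),
      P ^ (P.ramificationIdx ℤ / m)) ^ m = (Ideal.span {(p : ℤ)}).map (algebraMap ℤ (𝓞 K)) := by
    rw [Ideal.map_algebraMap_eq_finsetProd_pow hbot, ← Finset.prod_pow]
    refine Finset.prod_congr ?_ fun P hP => ?_
    · ext P
      rw [IsDedekindDomain.mem_primesOverFinset_iff hbot, Set.mem_toFinset]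
    · rw [Set.mem_toFinset, ← IsDedekindDomain.mem_primesOverFinset_iff hbot] at hP
      rw [← pow_mul, Nat.div_mul_cancel (hm.trans (Finset.gcd_dvd hP))]
  have hne : (∏ P ∈ IsDedekindDomain.primesOverFinset (Ideal.span {(p : ℤ)}) (𝓞 K),
      P ^ (P.ramificationIdx ℤ / m)) ≠ 0 := by
    refine Finset.prod_ne_zero_iff.mpr fun P hP => pow_ne_zero _ ?_
    have := ((IsDedekindDomain.mem_primesOverFinset_iff hbot _).mp hP).2
    exact Ideal.ne_bot_of_liesOver_of_ne_bot hbot P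
  exact ⟨⟨_, mem_nonZeroDivisors_iff_ne_zero.mpr hne⟩, hI⟩

/-- The norm of `(p)` is `(p) ^ [K : K']`; extracting `m`-th roots of ideals shows that the norm of
`I` is a power of `(p)`, hence principal. -/
theorem mk0_mem_relativeClassGroup {K' K : Type*} [Field K'] [NumberField K'] [Field K]
    [NumberField K] [Algebra K' K] {m p : ℕ} (hm : m ≠ 0) (hdvd : m ∣ Module.finrank K' K)
    {I : (Ideal (𝓞 K))⁰}
    (hI : (I : Ideal (𝓞 K)) ^ m = (Ideal.span {(p : ℤ)}).map (algebraMap ℤ (𝓞 K))) :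
    ClassGroup.mk0 I ∈ relativeClassGroup K' K := by
  obtain ⟨k, hk⟩ := hdvd
  have hfin : Module.finrank (𝓞 K') (𝓞 K) = Module.finrank K' K :=
    (IsFractionRing.finrank_eq (𝓞 K') K' (𝓞 K) K).symm
  have h1 : Ideal.relNorm (𝓞 K') (I : Ideal (𝓞 K)) ^ m =
      ((Ideal.span {(p : ℤ)}).map (algebraMap ℤ (𝓞 K')) ^ k) ^ m := by
    rw [← map_pow, hI, Ideal.relNorm_algebraMap', hfin, hk, ← pow_mul, mul_comm]
  have h2 := pow_left_injective hm h1
  rw [relativeClassGroup, MonoidHom.mem_ker, classGroupNorm_mk0, relNormNonzero]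
  refine (ClassGroup.mk0_eq_one_iff _).mpr ?_
  change (Ideal.relNorm (𝓞 K') (I : Ideal (𝓞 K))).IsPrincipal
  rw [h2, Ideal.map_span, Set.image_singleton, Ideal.span_singleton_pow]
  exact ⟨_, rfl⟩

theorem exists_eq_units_map_of_toPrincipalIdeal_eq_one {R K : Type*} [CommRing R] [IsDomain R]
    [Field K] [Algebra R K] [IsFractionRing R K] {x : Kˣ} (h : toPrincipalIdeal R K x = 1) :
    ∃ u : Rˣ, x = Units.map (algebraMap R K) u := by
  have h1 : FractionalIdeal.spanSingleton R⁰ (x : K) = 1 := by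
    rw [← coe_toPrincipalIdeal, h, Units.val_one]
  have h2 : FractionalIdeal.spanSingleton R⁰ ((x⁻¹ : Kˣ) : K) = 1 := by
    rw [← coe_toPrincipalIdeal, map_inv, h, inv_one, Units.val_one]
  obtain ⟨a, ha⟩ := (FractionalIdeal.mem_one_iff R⁰).mp
    (h1 ▸ FractionalIdeal.mem_spanSingleton_self R⁰ (x : K))
  obtain ⟨b, hb⟩ := (FractionalIdeal.mem_one_iff R⁰).mp
    (h2 ▸ FractionalIdeal.mem_spanSingleton_self R⁰ ((x⁻¹ : Kˣ) : K))
  have hab : a * b = 1 := IsFractionRing.injective R K (by rw [map_mul, ha, hb]; simp)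
  exact ⟨⟨a, b, hab, by rw [mul_comm, hab]⟩, Units.ext ha.symm⟩

theorem exists_toPrincipalIdeal_eq_of_mk_eq_one {R K : Type*} [CommRing R] [IsDomain R]
    [Field K] [Algebra R K] [IsFractionRing R K] {I : (FractionalIdeal R⁰ K)ˣ}
    (h : ClassGroup.mk K I = 1) : ∃ x : Kˣ, toPrincipalIdeal R K x = I := by
  have h1 := congrArg (ClassGroup.equiv K) h
  rw [ClassGroup.equiv_mk, map_one, QuotientGroup.mk'_apply, QuotientGroup.eq_one_iff] at h1
  obtain ⟨x, hx⟩ := h1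
  refine ⟨x, hx.trans (Units.ext ?_)⟩
  simp [FractionalIdeal.canonicalEquiv_self]

/-- If `x` generates `∏ (I_p ^ r) ^ c p`, then `x ^ q` and `∏ p ^ c p` generate the same fractional
ideal. -/
theorem mem_unitPowExponents_of_prod_mk0_eq_one {K : Type*} [Field K] [NumberField K]
    {q r : ℕ} {T : Finset ℕ} (hT : ∀ p ∈ T, p.Prime) (I : T → (Ideal (𝓞 K))⁰)
    (hI : ∀ p, (I p : Ideal (𝓞 K)) ^ (r * q) =
      (Ideal.span {((p : ℕ) : ℤ)}).map (algebraMap ℤ (𝓞 K)))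
    {c : T → ℤ} (h : ∏ p, (ClassGroup.mk0 (I p) ^ r) ^ c p = 1) :
    c ∈ unitPowExponents K hT q := by
  set J : T → (FractionalIdeal (𝓞 K)⁰ K)ˣ := fun p => FractionalIdeal.mk0 K (I p)
  have hJ : ∀ p, (J p ^ r) ^ q = toPrincipalIdeal (𝓞 K) K
      (Units.mk0 ((p : ℕ) : K) (Nat.cast_ne_zero.mpr (hT p p.2).ne_zero)) := by
    intro p
    apply Units.ext
    rw [coe_toPrincipalIdeal, ← pow_mul, Units.val_pow_eq_pow_val, FractionalIdeal.coe_mk0,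
      ← FractionalIdeal.coeIdeal_pow, hI, Ideal.map_span, Set.image_singleton,
      FractionalIdeal.coeIdeal_span_singleton]
    simp
  have h1 : ClassGroup.mk K (∏ p, (J p ^ r) ^ c p) = 1 := by
    rw [← h, map_prod]
    simp [J]
  obtain ⟨x, hx⟩ := exists_toPrincipalIdeal_eq_of_mk_eq_one h1
  have h2 : toPrincipalIdeal (𝓞 K) K (x ^ q * (primeProd K T hT c)⁻¹) = 1 := by
    rw [map_mul, map_inv, map_pow, hx, mul_inv_eq_one, primeProd, map_prod, ← Finset.prod_pow]
    refine Finset.prod_congr rfl fun p _ => ?_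
    rw [map_zpow, ← hJ, ← zpow_natCast, ← zpow_mul, mul_comm, zpow_mul, zpow_natCast]
  obtain ⟨u, hu⟩ := exists_eq_units_map_of_toPrincipalIdeal_eq_one h2
  exact ⟨x, u, by rw [← hu, inv_mul_cancel_right]⟩

/-! ### Comparison of indices -/

theorem card_le_groupRank_add {K' K : Type*} [Field K'] [NumberField K'] [Field K]
    [NumberField K] [Algebra K' K] {q l : ℕ} (hq : q.Prime) (hl : 1 ≤ l)
    (hdvd : q ^ l ∣ Module.finrank K' K) {T : Finset ℕ}
    (hT : ∀ p ∈ T, IsRamifiedPrimeOfType K (q ^ l) p) :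
    T.card ≤ groupRank q (powMonoidHom (q ^ (l - 1)) :
      relativeClassGroup K' K →* relativeClassGroup K' K).range +
      2 * (Module.finrank ℚ K - 1) := by
  set G := (powMonoidHom (q ^ (l - 1)) :
      relativeClassGroup K' K →* relativeClassGroup K' K).range
  have hTp : ∀ p ∈ T, p.Prime := fun p hp => (hT p hp).1
  have hm : q ^ l ≠ 0 := pow_ne_zero _ hq.ne_zero
  have hql : q ^ (l - 1) * q = q ^ l := by rw [← pow_succ, Nat.sub_add_cancel hl]
  choose I hI using fun p : T => exists_pow_eq_span_of_isRamifiedPrimeOfType (hT p p.2)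
  set a : T → relativeClassGroup K' K := fun p =>
    ⟨ClassGroup.mk0 (I p), mk0_mem_relativeClassGroup hm hdvd (hI p)⟩
  have ha : ∀ p, (a p) ^ q ^ l = 1 := by
    intro p
    apply Subtype.ext
    change ClassGroup.mk0 (I p) ^ q ^ l = 1
    rw [← map_pow]
    refine (ClassGroup.mk0_eq_one_iff (I p ^ q ^ l).2).mpr ?_
    rw [SubmonoidClass.coe_pow, hI, Ideal.map_span, Set.image_singleton]
    exact ⟨_, rfl⟩
  set g : T → G := fun p => ⟨a p ^ q ^ (l - 1), a p, rfl⟩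
  have hg : ∀ p, g p ^ q = 1 := fun p => Subtype.ext (by
    change (a p ^ q ^ (l - 1)) ^ q = 1
    rw [← pow_mul, hql, ha])
  let f : (T → ℤ) →+ Additive (powMonoidHom q : G →* G).ker :=
    AddMonoidHom.mk'
      (fun c => Additive.ofMul (∏ p, (⟨g p, hg p⟩ : (powMonoidHom q : G →* G).ker) ^ c p))
      fun c d => by
        simp only [Pi.add_apply, zpow_add, Finset.prod_mul_distrib, ofMul_mul]
  have hker : f.ker ≤ unitPowExponents K hTp q := by
    intro c hc
    refine mem_unitPowExponents_of_prod_mk0_eq_one (r := q ^ (l - 1)) hTp I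
      (fun p => by rw [hql]; exact hI p) ?_
    have h1 : ∏ p, (⟨g p, hg p⟩ : (powMonoidHom q : G →* G).ker) ^ c p = 1 := hc
    have h2 := congrArg (fun x : (powMonoidHom q : G →* G).ker =>
      (((x : G) : relativeClassGroup K' K) : ClassGroup (𝓞 K))) h1
    simpa [Subgroup.val_finsetProd, g, a] using h2
  have hn : 2 ≤ Module.finrank ℚ K := by
    have h1 : q ≤ Module.finrank K' K := Nat.le_of_dvd Module.finrank_pos
      ((dvd_pow_self q (by omega)).trans hdvd)
    have h2 : Module.finrank K' K ≤ Module.finrank ℚ K := by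
      rw [← Module.finrank_mul_finrank ℚ K' K]
      exact Nat.le_mul_of_pos_left _ Module.finrank_pos
    exact hq.two_le.trans (h1.trans h2)
  set n := Module.finrank ℚ K
  have hle₁ : mulExponents q T ≤ powExponents K hTp q := by
    intro c hc
    choose d hd using mem_mulExponents.mp hc
    refine ⟨primeProd K T hTp d, ?_⟩
    rw [primeProd, primeProd, ← Finset.prod_pow]
    refine Finset.prod_congr rfl fun p _ => ?_
    rw [hd, mul_comm, zpow_mul, zpow_natCast]
  have hle₂ : powExponents K hTp q ≤ unitPowExponents K hTp q := by
    rintro c ⟨x, hx⟩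
    exact ⟨x, 1, by rw [hx, map_one, one_mul]⟩
  have hi₁ : (mulExponents q T).relIndex (powExponents K hTp q) ≤ q ^ (n - 1) := by
    refine (relIndex_mulExponents_powExponents_le K hq hTp).trans ?_
    -- `n - 1 < q ^ (n - 1)` gives `n ≤ q ^ (n - 1)`.
    have := Nat.lt_pow_self (n := n - 1) hq.one_lt
    omega
  have hi₂ := relIndex_powExponents_unitPowExponents_le (K := K) hq hTp hn
  have hi₃ : (unitPowExponents K hTp q).index ≤ q ^ groupRank q G := by
    rw [← natCard_ker_powMonoidHom hq G]
    have h1 : f.ker.index ≤ Nat.card (powMonoidHom q : G →* G).ker := by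
      rw [AddSubgroup.index_ker]
      exact Nat.card_le_card_of_injective (fun x : f.range => Additive.toMul x.1)
        (Additive.toMul.injective.comp Subtype.val_injective)
    -- An infinite index would be recorded as `0`, and divisibility would then bound nothing.
    have h2 : f.ker.index ≠ 0 := by
      rw [AddSubgroup.index_ker]
      have : Finite (Additive (powMonoidHom q : G →* G).ker) := .of_equiv _ Additive.ofMul
      exact Nat.card_pos.ne'
    exact (Nat.le_of_dvd (Nat.pos_of_ne_zero h2) (AddSubgroup.index_dvd_of_le hker)).trans h1
  have htot : q ^ T.card ≤ q ^ (groupRank q G + 2 * (n - 1)) := by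
    rw [← Fintype.card_coe T, ← index_mulExponents,
      ← AddSubgroup.relIndex_mul_index (hle₁.trans hle₂),
      ← AddSubgroup.relIndex_mul_relIndex _ _ _ hle₁ hle₂, two_mul, pow_add, pow_add, mul_comm]
    exact Nat.mul_le_mul hi₃ (Nat.mul_le_mul hi₁ hi₂)
  exact (Nat.pow_le_pow_iff_right hq.one_lt).mp htot

end

theorem mainTheorem6 (K : Type*) [Field K] [NumberField K]
    (K' : Type*) [Field K'] [NumberField K'] [Algebra K' K]
    (n : ℕ) (hn : Module.finrank ℚ K = n)
    (q l : ℕ) (hq : q.Prime) (hl : 1 ≤ l)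
    (hdvd : q ^ l ∣ Module.finrank K' K) (hexact : ¬ q ^ (l + 1) ∣ Module.finrank K' K) :
    {p : ℕ | IsRamifiedPrimeOfType K (q ^ l) p}.Finite ∧
      ({p : ℕ | IsRamifiedPrimeOfType K (q ^ l) p}.ncard : ℤ) - 2 * ((n : ℤ) - 1) ≤
        (groupRank q
          (powMonoidHom (q ^ (l - 1)) :
            relativeClassGroup K' K →* relativeClassGroup K' K).range : ℤ) := by
  have hfin : {p : ℕ | IsRamifiedPrimeOfType K (q ^ l) p}.Finite := by
    -- An infinite set would contain a finite subset one element larger than the bound allows.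
    by_contra hinf
    obtain ⟨T, hT, hcard⟩ := Set.Infinite.exists_subset_card_eq hinf
      (groupRank q (powMonoidHom (q ^ (l - 1)) :
        relativeClassGroup K' K →* relativeClassGroup K' K).range +
        2 * (Module.finrank ℚ K - 1) + 1)
    have := card_le_groupRank_add (K' := K') hq hl hdvd (T := T) fun p hp => hT hp
    omega
  refine ⟨hfin, ?_⟩
  have h := card_le_groupRank_add (K' := K') hq hl hdvd (T := hfin.toFinset)
    fun p hp => hfin.mem_toFinset.mp hp
  have hpos : 0 < Module.finrank ℚ K := Module.finrank_pos
  rw [Set.ncard_eq_toFinset_card _ hfin]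
  omega
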